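/- Consider $n$ computers that communicate in synchronous rounds; in each round each computer can send at most one message to another computer and receive at most one message, and local computation is free. Let $\hat A,\hat B,\hat X\in\{0,1\}^{n\times n}$ be indicator matrices, each with at most $d$ non-zero entries in every row and in every column; they are known in advance, so the algorithm may depend on them (supported low-bandwidth model). At run time the input consists of $n\times n$ matrices $A,B$ over a semiring $S$ with $A_{ij}=0$ whenever $\hat A_{ij}=0$ and $B_{jk}=0$ whenever $\hat B_{jk}=0$; initially computer $i$ knows only row $i$ of $A$ and row $i$ of $B$. The task is that computer $i$ outputs $X_{ik}=\sum_j A_{ij}B_{jk}$ for every $k$ with $\hat X_{ik}\neq 0$. Theorem 2. There is an absolute constant $C$ such that for all $n,d$ and all such $\hat A,\hat B,\hat X$ there is a number of rounds $T\le C\,d^{1.927}$ for which the following hold. (i) For every $b$ and every semiring $S$ whose elements can be encoded in $b$ bits (for example $b=O(\log n)$), some algorithm with $b$-bit messages solves the task over $S$ in $T$ rounds. (ii) There is one algorithm that solves the task in $T$ rounds over every semiring $S$, finite or infinite, with messages that consist of a single element of $S$; its communication pattern is fixed in advance, and all messages and outputs are computed from locally known elements by semiring operations only. -/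

import Mathlib

/-! Uniformly sparse matrix multiplication in the supported low-bandwidth model. -/

namespace LowBandwidth

/-- An indicator matrix is uniformly sparse with parameter `d` if every row and every column
has at most `d` nonzero entries. -/
def UniformlySparse {n : ℕ} (d : ℕ) (M : Matrix (Fin n) (Fin n) Bool) : Prop :=
  (∀ i, (Finset.univ.filter fun j => M i j = true).card ≤ d) ∧
  (∀ j, (Finset.univ.filter fun i => M i j = true).card ≤ d)

/-- The matrix `M` vanishes wherever the indicator matrix `P` does. -/
def SupportedBy {n : ℕ} {S : Type*} [Zero S] (M : Matrix (Fin n) (Fin n) S)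
    (P : Matrix (Fin n) (Fin n) Bool) : Prop :=
  ∀ i j, P i j = false → M i j = 0

/-- The input of computer `i`: row `i` of each of the two input matrices. -/
structure LocalInput (n : ℕ) (S : Type*) where
  rowA : Fin n → S
  rowB : Fin n → S

/-- The input that each computer receives when the input matrices are `A` and `B`. -/
def localInputs {n : ℕ} {S : Type*} (A B : Matrix (Fin n) (Fin n) S) (v : Fin n) :
    LocalInput n S :=
  ⟨A v, B v⟩

/-- An algorithm for `n` computers that communicate by messages from `M`, where matrix entries
are from `S`. The local memory of a computer is its input together with the list of what it has
received in each past round (`none` if it received nothing; the oldest round comes first, so the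
length of the list is the number of past rounds). Local computation is not restricted.
* `send v x h`: what computer `v` does in the next round, given its input `x` and its
  history `h`; either nothing or to send one message to one computer.
* `output v x h`: the row that computer `v` outputs, given its input and its history. -/
structure Algorithm (n : ℕ) (S M : Type*) where
  send : Fin n → LocalInput n S → List (Option M) → Option (Fin n × M)
  output : Fin n → LocalInput n S → List (Option M) → Fin n → S

namespace Algorithm

variable {n : ℕ} {S M : Type*}

/-- What computer `v` receives in a round in which computer `u` performs the action `act u`.
(Solving a problem includes that no computer is sent two messages in the same round, so that
the order in which the senders are inspected does not matter.) -/
def received (act : Fin n → Option (Fin n × M)) (v : Fin n) : Option M :=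
  (List.finRange n).findSome? fun u =>
    (act u).bind fun p => if p.1 = v then some p.2 else none

/-- The history of each computer after `t` rounds. -/
def history (P : Algorithm n S M) (x : Fin n → LocalInput n S) : ℕ → Fin n → List (Option M)
  | 0 => fun _ => []
  | t + 1 => fun v =>
      P.history x t v ++ [received (fun u => P.send u (x u) (P.history x t u)) v]

/-- In round `t` no computer is sent more than one message. -/
def ConflictFree (P : Algorithm n S M) (x : Fin n → LocalInput n S) (t : ℕ) : Prop :=
  ∀ (u u' w : Fin n) (m m' : M),
    P.send u (x u) (P.history x t u) = some (w, m) →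
    P.send u' (x u') (P.history x t u') = some (w, m') → u = u'

/-- The algorithm solves, in `T` rounds, the matrix multiplication problem whose structure is
given by the indicator matrices `Ahat`, `Bhat`, `Xhat`: for all input matrices `A` and `B` with
that structure, in each of the first `T` rounds each computer sends and receives at most one
message, and after `T` rounds computer `i` outputs the entry `(i, k)` of the product `A * B`
for each `k` with `Xhat i k ≠ 0`. -/
def Solves [Semiring S] (P : Algorithm n S M) (T : ℕ)
    (Ahat Bhat Xhat : Matrix (Fin n) (Fin n) Bool) : Prop :=
  ∀ A B : Matrix (Fin n) (Fin n) S, SupportedBy A Ahat → SupportedBy B Bhat →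
    (∀ t < T, P.ConflictFree (localInputs A B) t) ∧
    ∀ i k, Xhat i k = true →
      P.output i (localInputs A B i) (P.history (localInputs A B) T i) k = ∑ j, A i j * B j k

end Algorithm

/-- The semiring elements that a computer may know: the entries of its row of the first input
matrix, those of its row of the second one, and what it received in round `s`. -/
inductive LocalVar (n : ℕ) where
  | entryA (j : Fin n)
  | entryB (k : Fin n)
  | message (s : ℕ)

/-- An algebraic algorithm: the communication pattern is fixed in advance, every message is one
semiring element, and all messages and outputs are computed from locally known elements by
semiring operations only (expressed as elements of the free noncommutative semiring over
`LocalVar n`). It does not depend on the semiring.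
* `dest v t`: the computer to which `v` sends a message in round `t`, if any.
* `msg v t`: how `v` computes this message.
* `out v k`: how `v` computes the entry `(v, k)` of the product. -/
structure AlgebraicAlgorithm (n : ℕ) where
  dest : Fin n → ℕ → Option (Fin n)
  msg : Fin n → ℕ → FreeAlgebra ℕ (LocalVar n)
  out : Fin n → Fin n → FreeAlgebra ℕ (LocalVar n)

namespace AlgebraicAlgorithm

variable {n : ℕ}

/-- The value of a local variable, given the input and the history of the computer (`0` for a
round in which nothing has been received). -/
def value {S : Type*} [Semiring S] (x : LocalInput n S) (h : List (Option S)) : LocalVar n → S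
  | .entryA j => x.rowA j
  | .entryB k => x.rowB k
  | .message s => (h[s]?.join).getD 0

/-- The execution of an algebraic algorithm over the semiring `S`. -/
noncomputable def interpret (P : AlgebraicAlgorithm n) (S : Type*) [Semiring S] : Algorithm n S S where
  send v x h := (P.dest v h.length).map fun w =>
    (w, FreeAlgebra.lift ℕ (value x h) (P.msg v h.length))
  output v x h k := FreeAlgebra.lift ℕ (value x h) (P.out v k)

end AlgebraicAlgorithm

end LowBandwidth

/-!
A *triangle* is a triple `(i, j, k)` with all of `Ahat i j`, `Bhat j k`, `Xhat i k` nonzero; each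
triangle is one product `A i j * B j k` to be added to the output entry `(i, k)`. There are at most
`d ^ 2 * n` triangles. The algorithm assigns every triangle to a computer. What a computer has to
pay for is not the number of its triangles but the number of entries of the three matrices that
they touch, since it fetches each input entry once and returns one partial sum for each
output entry. Rounding `d` up to an eighth power `r ^ 8`, the proof needs `O(r ^ 15)`
rounds, that is, `O(d ^ (15 / 8))`, and `15 / 8 < 1.927`.

*Clustering* (`exists_light_assignment`): each computer touches at most `2 * r ^ 14` entries of
each matrix. By `exists_light_dense`, as long as at least `r ^ 14 * n` triangles are left, some
`r ^ 16` of them touch at most `r ^ 14` entries of each matrix. Indeed, by Cauchy-Schwarz over the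
pairs `(j, k)`, there are on average `r ^ 20` triangles `(i, j, k)` per node `i₀` such that
`(i₀, j, k)` is a triangle too. Cut the neighbours `j` of `i₀`, and likewise its neighbours `k`,
into `r ^ 2` chunks of size `r ^ 6`; some pair of chunks leaves `r ^ 16` triangles. As `j` and `k`
then lie in sets of size `r ^ 6`, sparsity bounds the number of entries by `r ^ 6 * r ^ 8`.
There are at most `r ^ 16 * n` triangles, so this stops after `n` extractions, one per computer,
and the remaining triangles are spread evenly.

*Communication*: the messages of a bipartite multigraph of maximum degree `Δ` are delivered in
`2 * Δ` rounds, by a greedy edge colouring (`Reachable.route`). Each input entry is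
requested by at most `r ^ 8` computers. They are split into `r ^ 7` groups of size `r`; the
owner sends the entry to a leader of each group, who passes it on (`Reachable.deliver`). Both steps
have degree `O(r ^ 15)`. Partial sums travel the opposite way (`Reachable.gather`).

*Algorithms*: the communication is planned over the free semiring on the matrix entries
(`Reachable`). `Reachable.exists_solves` turns such a plan into an algebraic algorithm; the
algorithm with `b`-bit messages runs the algebraic one on encoded semiring elements.
-/

namespace LowBandwidth

open Finset

/-! ### Light sets of triangles -/

theorem exists_balanced_partition {α : Type*} [DecidableEq α] (W : Finset α) {s q : ℕ}
    (h : #W ≤ s * q) :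
    ∃ c : α → ℕ, (∀ a ∈ W, c a < q) ∧ ∀ b, #{a ∈ W | c a = b} ≤ s := by
  rcases Nat.eq_zero_or_pos s with rfl | hs
  · have : W = ∅ := by simpa using h
    subst this
    exact ⟨fun _ => 0, by simp, by simp⟩
  obtain ⟨f, hlt, hinj⟩ : ∃ f : α → ℕ, (∀ a ∈ W, f a < #W) ∧ Set.InjOn f W := by
    refine ⟨fun a => if h : a ∈ W then W.equivFin ⟨a, h⟩ else 0, fun a ha => ?_, ?_⟩
    · simp [ha]
    · intro a ha b hb hab
      have ha' : a ∈ W := ha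
      have hb' : b ∈ W := hb
      simpa [ha', hb', Fin.val_inj] using hab
  refine ⟨fun a => f a / s, fun a ha => ?_, fun b => ?_⟩
  · exact Nat.div_lt_of_lt_mul ((hlt a ha).trans_le h)
  · calc #{a ∈ W | f a / s = b} ≤ #(Ico (s * b) (s * b + s)) := by
          refine card_le_card_of_injOn f (fun a ha => ?_) (hinj.mono fun a ha => ?_)
          · have ha := (mem_filter.1 ha).2
            have h1 := Nat.div_add_mod (f a) s
            have h2 := Nat.mod_lt (f a) hs
            rw [ha] at h1
            simp only [coe_Ico, Set.mem_Ico]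
            omega
          · exact (mem_filter.1 ha).1
      _ = s := by simp

theorem UniformlySparse.mono {n d d' : ℕ} {M : Matrix (Fin n) (Fin n) Bool} (hdd : d ≤ d')
    (h : UniformlySparse d M) : UniformlySparse d' M :=
  ⟨fun i => (h.1 i).trans hdd, fun j => (h.2 j).trans hdd⟩

section Triangles

variable {n : ℕ}

/-- The triples `(i, j, k)` for which the product `A i j * B j k` contributes to a requested
output entry. -/
def triangles (Ahat Bhat Xhat : Matrix (Fin n) (Fin n) Bool) :
    Finset (Fin n × Fin n × Fin n) :=
  {t | Ahat t.1 t.2.1 = true ∧ Bhat t.2.1 t.2.2 = true ∧ Xhat t.1 t.2.2 = true}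

/-- The entry of the first matrix used by a triangle. -/
def pairA (t : Fin n × Fin n × Fin n) : Fin n × Fin n := (t.1, t.2.1)

/-- The entry of the second matrix used by a triangle. -/
def pairB (t : Fin n × Fin n × Fin n) : Fin n × Fin n := t.2

/-- The entry of the product to which a triangle contributes. -/
def pairX (t : Fin n × Fin n × Fin n) : Fin n × Fin n := (t.1, t.2.2)

/-- A set of triangles is light if it touches few entries of each of the three matrices. These
numbers, rather than the number of triangles, are what it costs one computer to process it. -/
def Light (κ : ℕ) (T : Finset (Fin n × Fin n × Fin n)) : Prop :=
  #(T.image pairA) ≤ κ ∧ #(T.image pairB) ≤ κ ∧ #(T.image pairX) ≤ κ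

theorem Light.of_card_le {κ : ℕ} {T : Finset (Fin n × Fin n × Fin n)} (h : #T ≤ κ) :
    Light κ T :=
  ⟨card_image_le.trans h, card_image_le.trans h, card_image_le.trans h⟩

theorem Light.mono {κ : ℕ} {T T' : Finset (Fin n × Fin n × Fin n)} (h : T' ⊆ T)
    (hT : Light κ T) : Light κ T' :=
  ⟨(card_le_card (image_subset_image h)).trans hT.1,
    (card_le_card (image_subset_image h)).trans hT.2.1,
    (card_le_card (image_subset_image h)).trans hT.2.2⟩

theorem Light.union {κ κ' : ℕ} {T T' : Finset (Fin n × Fin n × Fin n)} (hT : Light κ T)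
    (hT' : Light κ' T') : Light (κ + κ') (T ∪ T') := by
  refine ⟨?_, ?_, ?_⟩ <;> rw [image_union]
  · exact (card_union_le _ _).trans (add_le_add hT.1 hT'.1)
  · exact (card_union_le _ _).trans (add_le_add hT.2.1 hT'.2.1)
  · exact (card_union_le _ _).trans (add_le_add hT.2.2 hT'.2.2)

variable {Ahat Bhat Xhat : Matrix (Fin n) (Fin n) Bool}

/-- The support of a uniformly sparse matrix has few elements in the rows in `R`. -/
theorem UniformlySparse.card_le_of_fst {d s : ℕ} {M : Matrix (Fin n) (Fin n) Bool}
    (hM : UniformlySparse d M) {R : Finset (Fin n)} (hR : #R ≤ s) {E : Finset (Fin n × Fin n)}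
    (hE : ∀ e ∈ E, e.1 ∈ R ∧ M e.1 e.2 = true) : #E ≤ s * d := by
  refine (card_le_mul_card_image_of_maps_to (f := Prod.fst) (t := R) (fun e he => (hE e he).1) d
    fun i _ => ?_).trans (by rw [mul_comm]; gcongr)
  refine le_trans (card_le_card_of_injOn Prod.snd (fun e he => ?_) ?_) (hM.1 i)
  · obtain ⟨he', rfl⟩ := mem_filter.1 he
    simpa using (hE e he').2
  · rintro ⟨a, b⟩ he ⟨a', b'⟩ he' h
    have h1 := (mem_filter.1 he).2
    have h2 := (mem_filter.1 he').2
    simp_all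

/-- The support of a uniformly sparse matrix has few elements in the columns in `R`. -/
theorem UniformlySparse.card_le_of_snd {d s : ℕ} {M : Matrix (Fin n) (Fin n) Bool}
    (hM : UniformlySparse d M) {R : Finset (Fin n)} (hR : #R ≤ s) {E : Finset (Fin n × Fin n)}
    (hE : ∀ e ∈ E, e.2 ∈ R ∧ M e.1 e.2 = true) : #E ≤ s * d := by
  refine (card_le_mul_card_image_of_maps_to (f := Prod.snd) (t := R) (fun e he => (hE e he).1) d
    fun i _ => ?_).trans (by rw [mul_comm]; gcongr)
  refine le_trans (card_le_card_of_injOn Prod.fst (fun e he => ?_) ?_) (hM.2 i)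
  · obtain ⟨he', rfl⟩ := mem_filter.1 he
    simpa using (hE e he').2
  · rintro ⟨a, b⟩ he ⟨a', b'⟩ he' h
    have h1 := (mem_filter.1 he).2
    have h2 := (mem_filter.1 he').2
    simp_all

theorem UniformlySparse.card_support_le {d : ℕ} {M : Matrix (Fin n) (Fin n) Bool}
    (hM : UniformlySparse d M) {E : Finset (Fin n × Fin n)}
    (hE : ∀ e ∈ E, M e.1 e.2 = true) : #E ≤ n * d :=
  hM.card_le_of_fst (R := univ) (by simp) fun e he => ⟨mem_univ _, hE e he⟩

theorem card_triangles_le {d : ℕ} (hA : UniformlySparse d Ahat) (hX : UniformlySparse d Xhat) :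
    #(triangles Ahat Bhat Xhat) ≤ d * (n * d) := by
  refine (card_le_mul_card_image (f := pairA) _ d fun e _ => ?_).trans ?_
  · refine le_trans (card_le_card_of_injOn (fun t => t.2.2) (fun t ht => ?_) ?_) (hX.1 e.1)
    · obtain ⟨ht', rfl⟩ := mem_filter.1 ht
      exact mem_coe.2 (mem_filter.2 ⟨mem_univ _, (mem_filter.1 ht').2.2.2⟩)
    · rintro ⟨a, b, c⟩ ht ⟨a', b', c'⟩ ht' h
      have h1 := (mem_filter.1 ht).2
      have h2 := (mem_filter.1 ht').2
      subst h1
      simp only [pairA, Prod.mk.injEq] at h2 h ⊢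
      tauto
  · gcongr
    refine hA.card_support_le fun e he => ?_
    obtain ⟨t, ht, rfl⟩ := mem_image.1 he
    exact (mem_filter.1 ht).2.1

/-- A large set of triangles has a light subset with many triangles per touched entry. -/
theorem exists_light_dense {r : ℕ} (hr : 0 < r) (hn : 0 < n)
    (hA : UniformlySparse (r ^ 8) Ahat) (hB : UniformlySparse (r ^ 8) Bhat)
    (hX : UniformlySparse (r ^ 8) Xhat) {T : Finset (Fin n × Fin n × Fin n)}
    (hT : T ⊆ triangles Ahat Bhat Xhat) (hcard : r ^ 14 * n ≤ #T) :
    ∃ T' ⊆ T, r ^ 16 ≤ #T' ∧ Light (r ^ 14) T' := by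
  have hmem : ∀ t ∈ T, Ahat t.1 t.2.1 = true ∧ Bhat t.2.1 t.2.2 = true ∧ Xhat t.1 t.2.2 = true :=
    fun t ht => (mem_filter.1 (hT ht)).2
  have h8 : r ^ 8 = r ^ 6 * r ^ 2 := by ring
  choose cA hcA hcA' using fun i => exists_balanced_partition _ ((hA.1 i).trans h8.le)
  choose cX hcX hcX' using fun i => exists_balanced_partition _ ((hX.1 i).trans h8.le)
  -- Pairs of triangles with a common edge `(j, k)`. The second one provides the node `i₀`.
  set Q := (T ×ˢ T).filter fun p => p.1.2 = p.2.2 with hQ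
  have hQcard : #T ^ 2 ≤ n * r ^ 8 * #Q := by
    have h1 : #T = ∑ e ∈ T.image pairB, #{t ∈ T | pairB t = e} :=
      card_eq_sum_card_fiberwise fun t ht => mem_image_of_mem _ ht
    have h2 : #Q = ∑ e ∈ T.image pairB, #{t ∈ T | pairB t = e} ^ 2 := by
      rw [card_eq_sum_card_fiberwise (f := fun p => pairB p.1) (t := T.image pairB)]
      · refine sum_congr rfl fun e _ => ?_
        rw [sq, ← card_product]
        congr 1
        ext ⟨t, t'⟩
        rw [mem_product, mem_filter, mem_filter, mem_filter, mem_filter, mem_product]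
        simp only [pairB]
        constructor
        · rintro ⟨⟨⟨h, h'⟩, h''⟩, rfl⟩
          exact ⟨⟨h, rfl⟩, h', h''.symm⟩
        · rintro ⟨⟨h, rfl⟩, h', h''⟩
          exact ⟨⟨⟨h, h'⟩, h''.symm⟩, rfl⟩
      · intro p hp
        exact mem_image_of_mem _ (mem_product.1 (mem_filter.1 hp).1).1
    rw [h2]
    refine (congrArg (· ^ 2) h1).le.trans (sq_sum_le_card_mul_sum_sq.trans ?_)
    gcongr
    refine hB.card_support_le fun e he => ?_
    obtain ⟨t, ht, rfl⟩ := mem_image.1 he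
    exact (hmem t ht).2.1
  -- The number of choices of `i₀` and of a chunk of its neighbours on either side is `n * r ^ 4`.
  have hQ16 : #((univ : Finset (Fin n)) ×ˢ range (r ^ 2) ×ˢ range (r ^ 2)) * r ^ 16 ≤ #Q := by
    have h1 : (r ^ 14 * n) ^ 2 ≤ n * r ^ 8 * #Q := le_trans (by gcongr) hQcard
    have h2 : 0 < n * r ^ 8 := by positivity
    refine Nat.le_of_mul_le_mul_left (le_trans (le_of_eq ?_) h1) h2
    simp only [card_product, card_univ, Fintype.card_fin, card_range]
    ring
  obtain ⟨⟨i₀, a, b⟩, -, hfib⟩ := exists_le_card_fiber_of_mul_le_card_of_maps_to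
    (f := fun p : (Fin n × Fin n × Fin n) × (Fin n × Fin n × Fin n) =>
      (p.2.1, cA p.2.1 p.2.2.1, cX p.2.1 p.2.2.2)) (fun p hp => by
        have h := hmem p.2 (mem_product.1 (mem_filter.1 hp).1).2
        simp only [mem_product, mem_univ, mem_range, true_and]
        exact ⟨hcA _ _ (by simpa using h.1), hcX _ _ (by simpa using h.2.2)⟩)
    ⟨(⟨0, hn⟩, 0, 0), by simp [hr]⟩ hQ16
  set J := (univ.filter fun j => Ahat i₀ j = true).filter fun j => cA i₀ j = a with hJ
  set K := (univ.filter fun k => Xhat i₀ k = true).filter fun k => cX i₀ k = b with hK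
  have h14 : r ^ 14 = r ^ 6 * r ^ 8 := by ring
  refine ⟨T.filter fun t => t.2.1 ∈ J ∧ t.2.2 ∈ K, filter_subset _ _, hfib.trans ?_, ?_, ?_, ?_⟩
  · refine card_le_card_of_injOn Prod.fst (fun p hp => ?_) ?_
    · obtain ⟨hp, hp'⟩ := mem_filter.1 hp
      obtain ⟨hp, he⟩ := mem_filter.1 hp
      obtain ⟨h1, h2⟩ := mem_product.1 hp
      simp only [Prod.mk.injEq] at hp'
      obtain ⟨rfl, rfl, rfl⟩ := hp'
      have h := hmem _ h2
      simp [hJ, hK, he, h.1, h.2.2, h1]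
    · rintro ⟨⟨i, j, k⟩, ⟨i', j', k'⟩⟩ hp ⟨⟨i₁, j₁, k₁⟩, ⟨i₁', j₁', k₁'⟩⟩ hp₁ h
      simp only [hQ, coe_filter, Set.mem_ofPred_eq, mem_filter, Prod.mk.injEq] at hp hp₁ h ⊢
      obtain ⟨⟨-, h1, h2⟩, h3, -⟩ := hp
      obtain ⟨⟨-, h1', h2'⟩, h3', -⟩ := hp₁
      obtain ⟨rfl, rfl, rfl⟩ := h
      subst h1 h2 h1' h2' h3 h3'
      simp
  · rw [h14]
    refine hA.card_le_of_snd (hcA' i₀ a) fun e he => ?_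
    obtain ⟨t, ht, rfl⟩ := mem_image.1 he
    obtain ⟨ht, h1, h2⟩ := mem_filter.1 ht
    exact ⟨h1, (hmem t ht).1⟩
  · rw [h14]
    refine hB.card_le_of_fst (hcA' i₀ a) fun e he => ?_
    obtain ⟨t, ht, rfl⟩ := mem_image.1 he
    obtain ⟨ht, h1, h2⟩ := mem_filter.1 ht
    exact ⟨h1, (hmem t ht).2.1⟩
  · rw [h14]
    refine hX.card_le_of_snd (hcX' i₀ b) fun e he => ?_
    obtain ⟨t, ht, rfl⟩ := mem_image.1 he
    obtain ⟨ht, h1, h2⟩ := mem_filter.1 ht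
    exact ⟨h2, (hmem t ht).2.2⟩

/-- Dense light sets are extracted greedily, at most `m` times, until few triangles are left;
these are divided into `n` further classes of at most `r ^ 14` triangles. -/
theorem exists_light_partition {r : ℕ} (hr : 0 < r) (hn : 0 < n)
    (hA : UniformlySparse (r ^ 8) Ahat) (hB : UniformlySparse (r ^ 8) Bhat)
    (hX : UniformlySparse (r ^ 8) Xhat) (m : ℕ) {T : Finset (Fin n × Fin n × Fin n)}
    (hT : T ⊆ triangles Ahat Bhat Xhat) (hcard : #T ≤ r ^ 14 * n + r ^ 16 * m) :
    ∃ p : Fin n × Fin n × Fin n → ℕ, (∀ t ∈ T, p t < n + m) ∧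
      ∀ b, Light (r ^ 14) {t ∈ T | p t = b} := by
  induction m generalizing T with
  | zero =>
    obtain ⟨c, hc, hc'⟩ := exists_balanced_partition T (by simpa using hcard)
    exact ⟨c, by simpa using hc, fun b => .of_card_le (hc' b)⟩
  | succ m ih =>
    rcases le_total (#T) (r ^ 14 * n) with h | h
    · obtain ⟨p, hp, hp'⟩ := ih hT (by omega)
      exact ⟨p, fun t ht => (hp t ht).trans (by omega), hp'⟩
    · obtain ⟨T', hT', hbig, hlight⟩ := exists_light_dense hr hn hA hB hX hT h
      obtain ⟨p, hp, hp'⟩ := ih (T := T \ T') (sdiff_subset.trans hT) (by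
        rw [card_sdiff_of_subset hT']
        rw [mul_add] at hcard
        omega)
      refine ⟨fun t => if t ∈ T' then n + m else p t, fun t ht => ?_, fun b => ?_⟩
      · by_cases h : t ∈ T'
        · simp [h]
        · have := hp t (by simp [ht, h])
          simp only [h, if_false]
          omega
      · by_cases hb : b = n + m
        · refine hlight.mono fun t ht => ?_
          obtain ⟨ht, hpt⟩ := mem_filter.1 ht
          by_contra h
          have := hp t (by simp [ht, h])
          simp only [h, if_false] at hpt
          omega
        · refine (hp' b).mono fun t ht => ?_
          obtain ⟨ht, hpt⟩ := mem_filter.1 ht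
          by_cases h : t ∈ T'
          · simp only [h, if_true] at hpt
            omega
          · simp only [h, if_false] at hpt
            simp [ht, h, hpt]

/-- The triangles can be assigned to the computers so that each computer has a light set. -/
theorem exists_light_assignment {r : ℕ} (hr : 0 < r)
    (hA : UniformlySparse (r ^ 8) Ahat) (hB : UniformlySparse (r ^ 8) Bhat)
    (hX : UniformlySparse (r ^ 8) Xhat) :
    ∃ p : Fin n × Fin n × Fin n → Fin n,
      ∀ w, Light (2 * r ^ 14) {t ∈ triangles Ahat Bhat Xhat | p t = w} := by
  rcases Nat.eq_zero_or_pos n with rfl | hn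
  · exact ⟨fun t => t.1, fun w => w.elim0⟩
  obtain ⟨p, hp, hp'⟩ := exists_light_partition hr hn hA hB hX n Subset.rfl (by
    have h1 : #(triangles Ahat Bhat Xhat) ≤ r ^ 8 * (n * r ^ 8) := card_triangles_le hA hX
    have h2 : r ^ 8 * (n * r ^ 8) = r ^ 16 * n := by ring
    omega)
  refine ⟨fun t => ⟨p t % n, Nat.mod_lt _ hn⟩, fun w => ?_⟩
  -- Computer `w` takes the two classes `w` and `n + w`.
  rw [two_mul]
  refine ((hp' w).union (hp' (n + w))).mono fun t ht => ?_
  obtain ⟨ht, hpt⟩ := mem_filter.1 ht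
  simp only [Fin.ext_iff] at hpt
  have h := hp t ht
  simp only [mem_union, mem_filter, ht, true_and]
  rcases lt_or_ge (p t) n with h' | h'
  · left
    rwa [Nat.mod_eq_of_lt h'] at hpt
  · right
    rw [Nat.mod_eq_sub_mod h', Nat.mod_eq_of_lt (by omega)] at hpt
    omega

end Triangles

/-! ### Symbolic executions -/

/-- Semiring expressions in the entries of the two input matrices; `Sum.inl (i, j)` stands for
the entry `(i, j)` of the first one and `Sum.inr (j, k)` for the entry `(j, k)` of the second. -/
abbrev Formula (n : ℕ) : Type := FreeAlgebra ℕ ((Fin n × Fin n) ⊕ (Fin n × Fin n))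

/-- The indeterminate for an entry of the first input matrix. -/
noncomputable def varA {n : ℕ} (e : Fin n × Fin n) : Formula n := FreeAlgebra.ι ℕ (Sum.inl e)

/-- The indeterminate for an entry of the second input matrix. -/
noncomputable def varB {n : ℕ} (e : Fin n × Fin n) : Formula n := FreeAlgebra.ι ℕ (Sum.inr e)

/-- What computer `v` can compute before the first round. -/
noncomputable def initialKnowledge {n : ℕ} (v : Fin n) : Subsemiring (Formula n) :=
  Subsemiring.closure (Set.range (fun j => varA (v, j)) ∪ Set.range fun k => varB (v, k))

/-- `Reachable t K` says that `t` rounds of communication, in which every message is an expression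
that its sender can compute, can bring about that each computer `v` can compute the
expressions in `K v`. -/
inductive Reachable {n : ℕ} : ℕ → (Fin n → Subsemiring (Formula n)) → Prop
  | init : Reachable 0 initialKnowledge
  | round {t : ℕ} {K : Fin n → Subsemiring (Formula n)} (act : Fin n → Option (Fin n × Formula n))
      (hK : Reachable t K) (hact : ∀ v w f, act v = some (w, f) → f ∈ K v)
      (hinj : ∀ u v w f g, act u = some (w, f) → act v = some (w, g) → u = v) :
      Reachable (t + 1) fun w => Subsemiring.closure (K w ∪ {f | ∃ v, act v = some (w, f)})

/-! ### Routing -/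

/-- Greedy edge colouring of a bipartite multigraph of maximum degree at most `Δ`. -/
theorem exists_edge_coloring {ι V : Type*} [DecidableEq ι] [DecidableEq V] (M : Finset ι)
    (src dst : ι → V) {Δ : ℕ} (hsrc : ∀ v, #{m ∈ M | src m = v} ≤ Δ)
    (hdst : ∀ v, #{m ∈ M | dst m = v} ≤ Δ) :
    ∃ c : ι → ℕ, (∀ m ∈ M, c m < 2 * Δ) ∧ ∀ m ∈ M, ∀ m' ∈ M, c m = c m' →
      (src m = src m' ∨ dst m = dst m') → m = m' := by
  induction M using Finset.induction_on with
  | empty => exact ⟨fun _ => 0, by simp, by simp⟩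
  | insert a M ha ih =>
    have hmono : ∀ f : ι → V, ∀ v, #{m ∈ M | f m = v} ≤ #{m ∈ insert a M | f m = v} := fun f v =>
      card_le_card (filter_subset_filter _ (subset_insert _ _))
    obtain ⟨c, hc, hc'⟩ := ih (fun v => (hmono src v).trans (hsrc v))
      fun v => (hmono dst v).trans (hdst v)
    have hlt : ∀ f : ι → V, #{m ∈ insert a M | f m = f a} ≤ Δ → #{m ∈ M | f m = f a} < Δ := by
      intro f hf
      rw [filter_insert, if_pos rfl, card_insert_of_notMem (by simp [ha])] at hf
      omega
    obtain ⟨k, hk, hk'⟩ : ∃ k ∈ range (2 * Δ),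
        k ∉ ({m ∈ M | src m = src a} ∪ {m ∈ M | dst m = dst a}).image c := by
      refine exists_mem_notMem_of_card_lt_card (card_image_le.trans_lt ?_)
      refine (card_union_le _ _).trans_lt ?_
      rw [card_range]
      have := hlt src (hsrc _)
      have := hlt dst (hdst _)
      omega
    have hne : ∀ m ∈ M, m ≠ a := fun m hm h => ha (h ▸ hm)
    have hk'' : ∀ m ∈ M, (src m = src a ∨ dst m = dst a) → c m ≠ k := fun m hm h hmk =>
      hk' (mem_image.2 ⟨m, by simpa [hm] using h, hmk⟩)
    refine ⟨Function.update c a k, fun m hm => ?_, fun m hm m' hm' h hs => ?_⟩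
    · rcases mem_insert.1 hm with rfl | hm
      · simpa using hk
      · simpa [hne m hm] using hc m hm
    · rcases mem_insert.1 hm with rfl | hM <;> rcases mem_insert.1 hm' with rfl | hM'
      · rfl
      · simp only [Function.update_self, Function.update_of_ne (hne m' hM')] at h
        exact absurd h.symm (hk'' m' hM' (hs.imp Eq.symm Eq.symm))
      · simp only [Function.update_self, Function.update_of_ne (hne m hM)] at h
        exact absurd h (hk'' m hM hs)
      · simp only [Function.update_of_ne (hne m hM), Function.update_of_ne (hne m' hM')] at h
        exact hc' m hM m' hM' h hs

section

variable {n t : ℕ} {K : Fin n → Subsemiring (Formula n)}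

/-- Messages that form a multigraph of maximum degree `Δ` can be delivered in `2 * Δ` rounds:
one round for each colour of an edge colouring. -/
theorem Reachable.route {ι : Type*} [DecidableEq ι] (hK : Reachable t K) (M : Finset ι)
    (src dst : ι → Fin n) (val : ι → Formula n) (hval : ∀ m ∈ M, val m ∈ K (src m)) {Δ : ℕ}
    (hsrc : ∀ v, #{m ∈ M | src m = v} ≤ Δ) (hdst : ∀ v, #{m ∈ M | dst m = v} ≤ Δ) :
    ∃ K', Reachable (t + 2 * Δ) K' ∧ (∀ v, K v ≤ K' v) ∧ ∀ m ∈ M, val m ∈ K' (dst m) := by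
  obtain ⟨c, hc, hc'⟩ := exists_edge_coloring M src dst hsrc hdst
  suffices h : ∀ k, ∃ K', Reachable (t + k) K' ∧ (∀ v, K v ≤ K' v) ∧
      ∀ m ∈ M, c m < k → val m ∈ K' (dst m) by
    obtain ⟨K', h1, h2, h3⟩ := h (2 * Δ)
    exact ⟨K', h1, h2, fun m hm => h3 m hm (hc m hm)⟩
  intro k
  induction k with
  | zero => exact ⟨K, hK, fun _ => le_rfl, by simp⟩
  | succ k ih =>
    obtain ⟨K', h1, h2, h3⟩ := ih
    classical
    let act : Fin n → Option (Fin n × Formula n) := fun v =>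
      if h : ∃ m ∈ M, c m = k ∧ src m = v then some (dst h.choose, val h.choose) else none
    have hact : ∀ v w f, act v = some (w, f) →
        ∃ m ∈ M, c m = k ∧ src m = v ∧ dst m = w ∧ val m = f := by
      intro v w f h
      by_cases hv : ∃ m ∈ M, c m = k ∧ src m = v
      · simp only [act, dif_pos hv, Option.some.injEq, Prod.mk.injEq] at h
        exact ⟨_, hv.choose_spec.1, hv.choose_spec.2.1, hv.choose_spec.2.2, h⟩
      · simp [act, dif_neg hv] at h
    have hact' : ∀ m ∈ M, c m = k → act (src m) = some (dst m, val m) := by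
      intro m hm hk
      have hv : ∃ m' ∈ M, c m' = k ∧ src m' = src m := ⟨m, hm, hk, rfl⟩
      have : hv.choose = m := hc' _ hv.choose_spec.1 _ hm (hv.choose_spec.2.1.trans hk.symm)
        (Or.inl hv.choose_spec.2.2)
      simp only [act, dif_pos hv, this]
    refine ⟨_, h1.round act ?_ ?_, fun v => ?_, fun m hm hmk => ?_⟩
    · intro v w f h
      obtain ⟨m, hm, -, rfl, -, rfl⟩ := hact v w f h
      exact h2 _ (hval m hm)
    · intro u v w f g hu hv
      obtain ⟨m, hm, hmk, rfl, hmw, -⟩ := hact u w f hu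
      obtain ⟨m', hm', hmk', rfl, hmw', -⟩ := hact v w g hv
      rw [hc' m hm m' hm' (hmk.trans hmk'.symm) (Or.inr (hmw.trans hmw'.symm))]
    · exact fun f hf => Subsemiring.subset_closure (Or.inl (h2 v hf))
    · rcases Nat.lt_succ_iff_lt_or_eq.1 hmk with h | h
      · exact Subsemiring.subset_closure (Or.inl (h3 m hm h))
      · exact Subsemiring.subset_closure (Or.inr ⟨_, hact' m hm h⟩)

/-- A set can be split into at most `g` groups of size at most `x`; `l` maps each element to the
leader of its group. -/
theorem exists_leaders {α : Type*} [DecidableEq α] (W : Finset α) {x g : ℕ} (h : #W ≤ x * g) :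
    ∃ l : α → α, (∀ w ∈ W, l w ∈ W) ∧ (∀ u, #{w ∈ W | l w = u} ≤ x) ∧ #(W.image l) ≤ g := by
  obtain ⟨c, hc, hc'⟩ := exists_balanced_partition W h
  classical
  let rep : ℕ → α → α := fun b a => if h : ∃ w ∈ W, c w = b then h.choose else a
  have hrep : ∀ w ∈ W, ∀ a, rep (c w) a ∈ W ∧ c (rep (c w) a) = c w ∧ rep (c w) a = rep (c w) w := by
    intro w hw a
    have hv : ∃ w' ∈ W, c w' = c w := ⟨w, hw, rfl⟩
    simp only [rep, dif_pos hv, and_true]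
    exact hv.choose_spec
  refine ⟨fun w => rep (c w) w, fun w hw => (hrep w hw w).1, fun u => ?_, ?_⟩
  · refine (card_le_card fun w hw => ?_).trans (hc' (c u))
    obtain ⟨hW, rfl⟩ := mem_filter.1 hw
    exact mem_filter.2 ⟨hW, (hrep w hW w).2.1.symm⟩
  · calc #(W.image fun w => rep (c w) w) ≤ #((W.image fun w => rep (c w) w).image c) := by
          refine (card_image_of_injOn ?_).ge
          intro u hu v hv huv
          obtain ⟨w, hw, rfl⟩ := mem_image.1 hu
          obtain ⟨w', hw', rfl⟩ := mem_image.1 hv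
          simp only [(hrep w hw w).2.1, (hrep w' hw' w').2.1] at huv
          simp only [huv]
          exact ((hrep w' hw' w).2.2)
      _ ≤ #(range g) := card_le_card fun b hb => by
          obtain ⟨u, hu, rfl⟩ := mem_image.1 hb
          obtain ⟨w, hw, rfl⟩ := mem_image.1 hu
          simpa [(hrep w hw w).2.1] using hc w hw
      _ = g := card_range g

/-- Bounds the degree of a node in a family of messages indexed by pairs `⟨e, w⟩`: at most `a`
entries `e` concern the node, and each of them accounts for at most `b` messages. -/
theorem card_sigma_filter_le {α β : Type*} [DecidableEq α] [DecidableEq β]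
    {E : Finset α} {F : α → Finset β} {P : (_ : α) × β → Prop} [DecidablePred P] {E' : Finset α}
    {a b N : ℕ} (hmem : ∀ e ∈ E, ∀ w ∈ F e, P ⟨e, w⟩ → e ∈ E') (hE' : #E' ≤ a)
    (hF : ∀ e ∈ E', #{w ∈ F e | P ⟨e, w⟩} ≤ b) (hN : a * b ≤ N) :
    #{m ∈ E.sigma F | P m} ≤ N := by
  have hsub : {m ∈ E.sigma F | P m} ⊆ E'.sigma fun e => {w ∈ F e | P ⟨e, w⟩} := by
    rintro ⟨e, w⟩ h
    simp only [mem_filter, mem_sigma] at h ⊢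
    exact ⟨hmem e h.1.1 w h.1.2 h.2, h.1.2, h.2⟩
  refine (card_le_card hsub).trans ?_
  rw [card_sigma]
  refine (sum_le_card_nsmul _ _ b hF).trans ?_
  rw [smul_eq_mul]
  exact (Nat.mul_le_mul_right b hE').trans hN

variable {E : Finset (Fin n × Fin n)} {own : Fin n × Fin n → Fin n}
  {W : Fin n × Fin n → Finset (Fin n)} {x g κ d Δ : ℕ}

/-- Every computer in `W e` learns the value `val e` from its owner. The owner sends the value to
the leaders of the groups of size `x` into which `W e` is split, and these pass it on. -/
theorem Reachable.deliver (hK : Reachable t K) (val : Fin n × Fin n → Formula n)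
    (hval : ∀ e ∈ E, val e ∈ K (own e)) (hx : 0 < x) (hW : ∀ e ∈ E, #(W e) ≤ x * g)
    (hown : ∀ v, #{e ∈ E | own e = v} ≤ d) (hreq : ∀ w, #{e ∈ E | w ∈ W e} ≤ κ)
    (hd : d * g ≤ Δ) (hκ : κ * x ≤ Δ) :
    ∃ K', Reachable (t + 4 * Δ) K' ∧ (∀ v, K v ≤ K' v) ∧ ∀ e ∈ E, ∀ w ∈ W e, val e ∈ K' w := by
  have hκ' : κ * 1 ≤ Δ := (Nat.mul_le_mul_left κ hx).trans hκ
  have hl : ∀ e, ∃ l : Fin n → Fin n, e ∈ E → (∀ w ∈ W e, l w ∈ W e) ∧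
      (∀ u, #{w ∈ W e | l w = u} ≤ x) ∧ #((W e).image l) ≤ g := fun e => by
    by_cases he : e ∈ E
    · obtain ⟨l, h⟩ := exists_leaders (W e) (hW e he)
      exact ⟨l, fun _ => h⟩
    · exact ⟨id, fun h => absurd h he⟩
  choose l hl using hl
  have himg : ∀ e ∈ E, ∀ u ∈ (W e).image (l e), u ∈ W e := fun e he u hu => by
    obtain ⟨w, hw, rfl⟩ := mem_image.1 hu
    exact (hl e he).1 w hw
  obtain ⟨K₁, h1, h2, h3⟩ := hK.route (E.sigma fun e => (W e).image (l e))
    (fun m => own m.1) (fun m => m.2) (fun m => val m.1) (Δ := Δ)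
    (fun m hm => hval _ (mem_sigma.1 hm).1)
    (fun v => card_sigma_filter_le (fun e he w _ h => by simpa [he] using h) (hown v)
      (fun e he => (card_le_card (filter_subset _ _)).trans (hl e (mem_filter.1 he).1).2.2) hd)
    (fun v => card_sigma_filter_le (E' := {e ∈ E | v ∈ W e})
      (fun e he w hw h => by subst h; simp [he, himg e he w hw]) (hreq v)
      (fun e he => card_le_one.2 fun a ha b hb =>
        (mem_filter.1 ha).2.trans (mem_filter.1 hb).2.symm) hκ')
  obtain ⟨K₂, h1', h2', h3'⟩ := h1.route (E.sigma W)
    (fun m => l m.1 m.2) (fun m => m.2) (fun m => val m.1) (Δ := Δ)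
    (fun m hm => by
      obtain ⟨he, hw⟩ := mem_sigma.1 hm
      exact h3 ⟨m.1, l m.1 m.2⟩ (mem_sigma.2 ⟨he, mem_image_of_mem _ hw⟩))
    (fun v => card_sigma_filter_le (E' := {e ∈ E | v ∈ W e})
      (fun e he w hw h => by subst h; simp [he, (hl e he).1 w hw]) (hreq v)
      (fun e he => (hl e (mem_filter.1 he).1).2.1 v) hκ)
    (fun v => card_sigma_filter_le (E' := {e ∈ E | v ∈ W e})
      (fun e he w hw h => by subst h; simp [he, hw]) (hreq v)
      (fun e he => card_le_one.2 fun a ha b hb =>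
        (mem_filter.1 ha).2.trans (mem_filter.1 hb).2.symm) hκ')
  refine ⟨K₂, ?_, fun v => (h2 v).trans (h2' v), fun e he w hw =>
    h3' ⟨e, w⟩ (mem_sigma.2 ⟨he, hw⟩)⟩
  convert h1' using 1
  ring

/-- The owner of `e` learns the sum of the values `val e w` held by the computers `w` in `W e`.
This is `Reachable.deliver` with the direction of the messages reversed: the leaders add up the
values of their groups. -/
theorem Reachable.gather (hK : Reachable t K) (val : Fin n × Fin n → Fin n → Formula n)
    (hval : ∀ e ∈ E, ∀ w ∈ W e, val e w ∈ K w) (hx : 0 < x) (hW : ∀ e ∈ E, #(W e) ≤ x * g)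
    (hown : ∀ v, #{e ∈ E | own e = v} ≤ d) (hreq : ∀ w, #{e ∈ E | w ∈ W e} ≤ κ)
    (hd : d * g ≤ Δ) (hκ : κ * x ≤ Δ) :
    ∃ K', Reachable (t + 4 * Δ) K' ∧ ∀ e ∈ E, ∑ w ∈ W e, val e w ∈ K' (own e) := by
  have hκ' : κ * 1 ≤ Δ := (Nat.mul_le_mul_left κ hx).trans hκ
  have hl : ∀ e, ∃ l : Fin n → Fin n, e ∈ E → (∀ w ∈ W e, l w ∈ W e) ∧
      (∀ u, #{w ∈ W e | l w = u} ≤ x) ∧ #((W e).image l) ≤ g := fun e => by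
    by_cases he : e ∈ E
    · obtain ⟨l, h⟩ := exists_leaders (W e) (hW e he)
      exact ⟨l, fun _ => h⟩
    · exact ⟨id, fun h => absurd h he⟩
  choose l hl using hl
  have himg : ∀ e ∈ E, ∀ u ∈ (W e).image (l e), u ∈ W e := fun e he u hu => by
    obtain ⟨w, hw, rfl⟩ := mem_image.1 hu
    exact (hl e he).1 w hw
  obtain ⟨K₁, h1, h2, h3⟩ := hK.route (E.sigma W)
    (fun m => m.2) (fun m => l m.1 m.2) (fun m => val m.1 m.2) (Δ := Δ)
    (fun m hm => hval _ (mem_sigma.1 hm).1 _ (mem_sigma.1 hm).2)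
    (fun v => card_sigma_filter_le (E' := {e ∈ E | v ∈ W e})
      (fun e he w hw h => by subst h; simp [he, hw]) (hreq v)
      (fun e he => card_le_one.2 fun a ha b hb =>
        (mem_filter.1 ha).2.trans (mem_filter.1 hb).2.symm) hκ')
    (fun v => card_sigma_filter_le (E' := {e ∈ E | v ∈ W e})
      (fun e he w hw h => by subst h; simp [he, (hl e he).1 w hw]) (hreq v)
      (fun e he => (hl e (mem_filter.1 he).1).2.1 v) hκ)
  obtain ⟨K₂, h1', h2', h3'⟩ := h1.route (E.sigma fun e => (W e).image (l e))
    (fun m => m.2) (fun m => own m.1)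
    (fun m => ∑ w ∈ (W m.1).filter (fun w => l m.1 w = m.2), val m.1 w) (Δ := Δ)
    (fun m hm => by
      refine sum_mem fun w hw => ?_
      obtain ⟨hw, hwm⟩ := mem_filter.1 hw
      have := h3 ⟨m.1, w⟩ (mem_sigma.2 ⟨(mem_sigma.1 hm).1, hw⟩)
      simpa only [hwm] using this)
    (fun v => card_sigma_filter_le (E' := {e ∈ E | v ∈ W e})
      (fun e he w hw h => by subst h; simp [he, himg e he w hw]) (hreq v)
      (fun e he => card_le_one.2 fun a ha b hb =>
        (mem_filter.1 ha).2.trans (mem_filter.1 hb).2.symm) hκ')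
    (fun v => card_sigma_filter_le (fun e he w _ h => by simpa [he] using h) (hown v)
      (fun e he => (card_le_card (filter_subset _ _)).trans (hl e (mem_filter.1 he).1).2.2) hd)
  refine ⟨K₂, ?_, fun e he => ?_⟩
  · convert h1' using 1
    ring
  · rw [← sum_fiberwise_of_maps_to fun w hw => mem_image_of_mem (l e) hw]
    exact sum_mem fun u hu => h3' ⟨e, u⟩ (mem_sigma.2 ⟨he, hu⟩)

end

/-! ### The product -/

/-- Every computer can learn its requested entries of the symbolic product in `O(r ^ 15)` rounds:
the entries of the first matrix are delivered to the computers whose triangles use them, then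
those of the second one, and finally the products are gathered. -/
theorem exists_reachable_product {n r : ℕ} (hr : 0 < r)
    {Ahat Bhat Xhat : Matrix (Fin n) (Fin n) Bool}
    (hA : UniformlySparse (r ^ 8) Ahat) (hB : UniformlySparse (r ^ 8) Bhat)
    (hX : UniformlySparse (r ^ 8) Xhat) :
    ∃ K, Reachable (24 * r ^ 15) K ∧ ∀ i k, Xhat i k = true →
      ∑ j with Ahat i j = true ∧ Bhat j k = true, varA (i, j) * varB (j, k) ∈ K i := by
  obtain ⟨p, hp⟩ := exists_light_assignment hr hA hB hX
  set T := triangles Ahat Bhat Xhat with hT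
  have hmem : ∀ t, t ∈ T ↔ Ahat t.1 t.2.1 = true ∧ Bhat t.2.1 t.2.2 = true ∧
      Xhat t.1 t.2.2 = true := fun t => by simp [hT, triangles]
  -- The computers whose triangles touch the entry `e` of the matrix to which `f` projects.
  let W (f : Fin n × Fin n × Fin n → Fin n × Fin n) (e : Fin n × Fin n) : Finset (Fin n) :=
    {t ∈ T | f t = e}.image p
  have hWcard : ∀ (f : Fin n × Fin n × Fin n → Fin n × Fin n)
      (h : Fin n × Fin n × Fin n → Fin n) (R : Fin n × Fin n → Finset (Fin n)) e,
      #(R e) ≤ r ^ 8 → (∀ t ∈ T, f t = e → h t ∈ R e) →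
      (∀ t t', f t = f t' → h t = h t' → t = t') → #(W f e) ≤ r * r ^ 7 := by
    intro f h R e hR hmem hinj
    have : r * r ^ 7 = r ^ 8 := by ring
    rw [this]
    refine card_image_le.trans (le_trans (card_le_card_of_injOn h (fun t ht => ?_) ?_) hR)
    · exact hmem t (mem_filter.1 ht).1 (mem_filter.1 ht).2
    · intro t ht t' ht' htt
      exact hinj t t' ((mem_filter.1 ht).2.trans (mem_filter.1 ht').2.symm) htt
  have hreq : ∀ (f : Fin n × Fin n × Fin n → Fin n × Fin n) (E : Finset (Fin n × Fin n)) w,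
      #({t ∈ T | p t = w}.image f) ≤ 2 * r ^ 14 → #{e ∈ E | w ∈ W f e} ≤ 2 * r ^ 14 := by
    intro f E w h
    refine (card_le_card fun e he => ?_).trans h
    obtain ⟨t, ht, rfl⟩ := mem_image.1 (mem_filter.1 he).2
    obtain ⟨hT, rfl⟩ := mem_filter.1 ht
    exact mem_image_of_mem f (mem_filter.2 ⟨hT, rfl⟩)
  have hown : ∀ {M : Matrix (Fin n) (Fin n) Bool}, UniformlySparse (r ^ 8) M → ∀ v,
      #{e ∈ univ.filter (fun e : Fin n × Fin n => M e.1 e.2 = true) | e.1 = v} ≤ r ^ 8 := by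
    intro M hM v
    simpa using hM.card_le_of_fst (R := {v}) (s := 1) (by simp) fun e he => by
      simpa [and_comm] using he
  have hd : r ^ 8 * r ^ 7 ≤ 2 * r ^ 15 := by
    rw [← pow_add]
    exact Nat.le_mul_of_pos_left _ two_pos
  have hκ : 2 * r ^ 14 * r ≤ 2 * r ^ 15 := by
    rw [mul_assoc, ← pow_succ]
  obtain ⟨K₁, h1, hK₁, hA₁⟩ := Reachable.init.deliver (own := Prod.fst)
    (E := univ.filter fun e => Ahat e.1 e.2 = true) (W := W pairA) varA
    (fun e _ => Subsemiring.subset_closure (Or.inl ⟨e.2, rfl⟩)) hr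
    (fun e _ => hWcard pairA (fun t => t.2.2) (fun e => {k | Xhat e.1 k = true}) e (hX.1 e.1)
      (by rintro t ht rfl; exact mem_filter.2 ⟨mem_univ _, ((hmem t).1 ht).2.2⟩)
      (fun t t' h h' => by
        simp only [pairA, Prod.mk.injEq] at h
        exact Prod.ext h.1 (Prod.ext h.2 h')))
    (hown hA) (fun w => hreq pairA _ w (hp w).1) hd hκ
  obtain ⟨K₂, h2, hK₂, hB₂⟩ := h1.deliver (own := Prod.fst)
    (E := univ.filter fun e => Bhat e.1 e.2 = true) (W := W pairB) varB
    (fun e _ => hK₁ _ (Subsemiring.subset_closure (Or.inr ⟨e.2, rfl⟩))) hr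
    (fun e _ => hWcard pairB (fun t => t.1) (fun e => {i | Ahat i e.1 = true}) e (hA.2 e.1)
      (by rintro t ht rfl; exact mem_filter.2 ⟨mem_univ _, ((hmem t).1 ht).1⟩)
      (fun t t' h h' => by
        simp only [pairB, Prod.ext_iff] at h
        exact Prod.ext h' (Prod.ext h.1 h.2)))
    (hown hB) (fun w => hreq pairB _ w (hp w).2.1) hd hκ
  obtain ⟨K₃, h3, hX₃⟩ := h2.gather (own := Prod.fst)
    (E := univ.filter fun e => Xhat e.1 e.2 = true) (W := W pairX)
    (fun e w => ∑ t ∈ T with pairX t = e ∧ p t = w, varA (pairA t) * varB (pairB t))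
    (fun e _ w _ => sum_mem fun t ht => by
      obtain ⟨hT, he, rfl⟩ := mem_filter.1 ht
      have := (hmem t).1 hT
      refine mul_mem (hK₂ _ (hA₁ _ ?_ _ ?_)) (hB₂ _ ?_ _ ?_)
      · exact mem_filter.2 ⟨mem_univ _, this.1⟩
      · exact mem_image_of_mem p (mem_filter.2 ⟨hT, rfl⟩)
      · exact mem_filter.2 ⟨mem_univ _, this.2.1⟩
      · exact mem_image_of_mem p (mem_filter.2 ⟨hT, rfl⟩)) hr
    (fun e _ => hWcard pairX (fun t => t.2.1) (fun e => {j | Ahat e.1 j = true}) e (hA.1 e.1)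
      (by rintro t ht rfl; exact mem_filter.2 ⟨mem_univ _, ((hmem t).1 ht).1⟩)
      (fun t t' h h' => by
        simp only [pairX, Prod.mk.injEq] at h
        exact Prod.ext h.1 (Prod.ext h' h.2)))
    (hown hX) (fun w => hreq pairX _ w (hp w).2.2) hd hκ
  refine ⟨K₃, ?_, fun i k hik => ?_⟩
  · convert h3 using 1
    ring
  · convert hX₃ (i, k) (by simpa using hik) using 1
    simp only [← filter_filter]
    rw [sum_fiberwise_of_maps_to fun t ht => mem_image_of_mem p ht]
    refine sum_nbij' (fun j => (i, j, k)) (fun t => t.2.1) ?_ ?_ ?_ ?_ ?_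
    · intro j hj
      simp only [mem_filter, mem_univ, true_and] at hj
      simp [hmem, hj, hik, pairX]
    · intro t ht
      obtain ⟨hT, he⟩ := mem_filter.1 ht
      simp only [pairX, Prod.mk.injEq] at he
      obtain ⟨rfl, rfl⟩ := he
      have := (hmem t).1 hT
      simp [this]
    · simp
    · intro t ht
      obtain ⟨ht, he⟩ := mem_filter.1 ht
      simp only [pairX, Prod.mk.injEq] at he
      obtain ⟨rfl, rfl⟩ := he
      rfl
    · simp [pairA, pairB]

/-! ### From symbolic executions to algorithms -/

section

variable {n : ℕ} {S M : Type*}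

theorem Algorithm.length_history (P : Algorithm n S M) (x : Fin n → LocalInput n S) (t : ℕ)
    (v : Fin n) : (P.history x t v).length = t := by
  induction t generalizing v with
  | zero => rfl
  | succ t ih => simp [Algorithm.history, ih]

theorem Algorithm.received_eq_some {act : Fin n → Option (Fin n × M)} {u v : Fin n} {m : M}
    (hu : act u = some (v, m))
    (huniq : ∀ u' m', act u' = some (v, m') → u' = u) :
    Algorithm.received act v = some m := by
  unfold Algorithm.received
  cases h : (List.finRange n).findSome? fun u =>
      (act u).bind fun p => if p.1 = v then some p.2 else none with
  | none =>
    rw [List.findSome?_eq_none_iff] at h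
    simpa [hu] using h u (List.mem_finRange u)
  | some m' =>
    obtain ⟨u', -, h'⟩ := List.exists_of_findSome?_eq_some h
    obtain ⟨⟨w, m''⟩, h1, h2⟩ := Option.bind_eq_some_iff.1 h'
    split_ifs at h2 with hw
    · simp only [Option.some.injEq] at h2
      subst h2
      simp only at hw
      subst hw
      have := huniq u' _ h1
      subst this
      simp_all

theorem Algorithm.history_congr {P Q : Algorithm n S M} {x : Fin n → LocalInput n S} {t : ℕ}
    (h : ∀ v l, l.length < t → P.send v (x v) l = Q.send v (x v) l) :
    P.history x t = Q.history x t := by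
  induction t with
  | zero => rfl
  | succ t ih =>
    have ih := ih fun v l hl => h v l (hl.trans t.lt_succ_self)
    funext v
    simp only [Algorithm.history]
    rw [ih]
    congr 3
    funext u
    exact h u _ (by rw [length_history]; exact t.lt_succ_self)

/-- The algorithm that simulates `P` with each message `m` sent in the form `enc m`. -/
def Algorithm.encode {N : Type*} (P : Algorithm n S M) (enc : M → N) (dec : N → M) :
    Algorithm n S N where
  send v x h := (P.send v x (h.map (Option.map dec))).map fun p => (p.1, enc p.2)
  output v x h := P.output v x (h.map (Option.map dec))

theorem Algorithm.received_map {N : Type*} (enc : M → N) (act : Fin n → Option (Fin n × M))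
    (v : Fin n) :
    Algorithm.received (fun u => (act u).map fun p => (p.1, enc p.2)) v =
      (Algorithm.received act v).map enc := by
  unfold Algorithm.received
  rw [List.map_findSome?]
  congr 1
  funext u
  simp only [Function.comp_apply]
  cases act u with
  | none => rfl
  | some p => by_cases h : p.1 = v <;> simp [h]

theorem Algorithm.history_encode {N : Type*} (P : Algorithm n S M) {enc : M → N} {dec : N → M}
    (hdec : Function.LeftInverse dec enc) (x : Fin n → LocalInput n S) (t : ℕ) (v : Fin n) :
    ((P.encode enc dec).history x t v).map (Option.map dec) = P.history x t v := by
  induction t generalizing v with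
  | zero => rfl
  | succ t ih =>
    simp only [Algorithm.history, List.map_append, ih, List.map_cons, List.map_nil]
    simp only [Algorithm.encode, Algorithm.received_map]
    have ih' := ih
    simp only [Algorithm.encode] at ih'
    simp [ih', hdec.comp_eq_id]

theorem Algorithm.Solves.encode [Semiring S] {N : Type*} {P : Algorithm n S M} {T : ℕ}
    {Ahat Bhat Xhat : Matrix (Fin n) (Fin n) Bool} (hP : P.Solves T Ahat Bhat Xhat)
    {enc : M → N} {dec : N → M} (hdec : Function.LeftInverse dec enc) :
    (P.encode enc dec).Solves T Ahat Bhat Xhat := by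
  intro A B hA hB
  obtain ⟨h1, h2⟩ := hP A B hA hB
  refine ⟨fun t ht u u' w m m' hu hu' => ?_, fun i k hik => ?_⟩
  · change Option.map _ (P.send _ _ (List.map _ _)) = _ at hu hu'
    rw [P.history_encode hdec] at hu hu'
    obtain ⟨⟨w₁, m₁⟩, hp, h⟩ := Option.map_eq_some_iff.1 hu
    obtain ⟨⟨w₂, m₂⟩, hp', h'⟩ := Option.map_eq_some_iff.1 hu'
    simp only [Prod.mk.injEq] at h h'
    obtain ⟨rfl, -⟩ := h
    obtain ⟨rfl, -⟩ := h'
    exact h1 t ht _ _ _ _ _ hp hp'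
  · change P.output _ _ (List.map _ _) k = _
    rw [P.history_encode hdec]
    exact h2 i k hik

end

section

universe u

variable {n : ℕ}

/-- The value of a symbolic expression for given input matrices. -/
noncomputable def Formula.eval {S : Type*} [Semiring S] (A B : Matrix (Fin n) (Fin n) S) :
    Formula n →ₐ[ℕ] S :=
  FreeAlgebra.lift ℕ (Sum.elim (fun e => A e.1 e.2) fun e => B e.1 e.2)

/-- The expressions that computer `v` can compute after `t` rounds of `P`. The local computation
must remain valid when the history is extended, so it may use no messages of later rounds. -/
def computable (P : AlgebraicAlgorithm n) (t : ℕ) (v : Fin n) : Subsemiring (Formula n) where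
  carrier := {f | ∃ e : FreeAlgebra ℕ (LocalVar n), ∀ (S : Type u) [Semiring S]
    (A B : Matrix (Fin n) (Fin n) S) (l : List (Option S)),
    FreeAlgebra.lift ℕ (AlgebraicAlgorithm.value (localInputs A B v)
      ((P.interpret S).history (localInputs A B) t v ++ l)) e = Formula.eval A B f}
  zero_mem' := ⟨0, by simp⟩
  one_mem' := ⟨1, by simp⟩
  add_mem' := by
    rintro f g ⟨e, he⟩ ⟨e', he'⟩
    exact ⟨e + e', fun S _ A B l => by rw [map_add, map_add, he, he']⟩
  mul_mem' := by
    rintro f g ⟨e, he⟩ ⟨e', he'⟩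
    exact ⟨e * e', fun S _ A B l => by rw [map_mul, map_mul, he, he']⟩

/-- A symbolic execution is carried out by an algebraic algorithm with a conflict-free
communication pattern. -/
theorem Reachable.exists_algorithm {t : ℕ} {K : Fin n → Subsemiring (Formula n)}
    (hK : Reachable t K) :
    ∃ P : AlgebraicAlgorithm n,
      (∀ s < t, ∀ u v w, P.dest u s = some w → P.dest v s = some w → u = v) ∧
      ∀ v, K v ≤ computable.{u} P t v := by
  induction hK with
  | init =>
    refine ⟨⟨fun _ _ => none, fun _ _ => 0, fun _ _ => 0⟩, by simp, fun v => ?_⟩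
    refine Subsemiring.closure_le.2 ?_
    rintro _ (⟨j, rfl⟩ | ⟨k, rfl⟩)
    · refine ⟨FreeAlgebra.ι ℕ (.entryA j), fun S _ A B l => ?_⟩
      simp [AlgebraicAlgorithm.value, Formula.eval, varA, localInputs]
    · refine ⟨FreeAlgebra.ι ℕ (.entryB k), fun S _ A B l => ?_⟩
      simp [AlgebraicAlgorithm.value, Formula.eval, varB, localInputs]
  | @round t K act hK hact hinj ih =>
    obtain ⟨P, hP, hKP⟩ := ih
    have hex : ∀ v, ∃ e : FreeAlgebra ℕ (LocalVar n), ∀ w f, act v = some (w, f) →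
        ∀ (S : Type u) [Semiring S] (A B : Matrix (Fin n) (Fin n) S),
          FreeAlgebra.lift ℕ (AlgebraicAlgorithm.value (localInputs A B v)
            ((P.interpret S).history (localInputs A B) t v)) e = Formula.eval A B f := by
      intro v
      cases h : act v with
      | none => exact ⟨0, by simp⟩
      | some p =>
        obtain ⟨e, he⟩ := hKP v (hact v p.1 p.2 h)
        refine ⟨e, fun w f hf S _ A B => ?_⟩
        obtain rfl : p = (w, f) := by simpa using hf
        simpa using he S A B []
    choose e he using hex
    -- `P` with its behaviour in round `t` replaced.
    let Q : AlgebraicAlgorithm n :=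
      { dest := fun v s => if s = t then (act v).map Prod.fst else P.dest v s
        msg := fun v s => if s = t then e v else P.msg v s
        out := P.out }
    have hhist : ∀ (S : Type u) [Semiring S] (A B : Matrix (Fin n) (Fin n) S),
        (Q.interpret S).history (localInputs A B) t =
          (P.interpret S).history (localInputs A B) t := by
      intro S _ A B
      refine Algorithm.history_congr fun v l hl => ?_
      simp [AlgebraicAlgorithm.interpret, Q, hl.ne]
    have hsend : ∀ (S : Type u) [Semiring S] (A B : Matrix (Fin n) (Fin n) S) (v : Fin n),
        (Q.interpret S).send v (localInputs A B v)
          ((Q.interpret S).history (localInputs A B) t v) =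
          (act v).map fun p => (p.1, Formula.eval A B p.2) := by
      intro S _ A B v
      have hQ : ∀ h : List (Option S), h.length = t →
          (Q.interpret S).send v (localInputs A B v) h = ((act v).map Prod.fst).map fun w =>
            (w, FreeAlgebra.lift ℕ (AlgebraicAlgorithm.value (localInputs A B v) h) (e v)) := by
        intro h hh
        simp [AlgebraicAlgorithm.interpret, Q, hh]
      rw [hhist, hQ _ (Algorithm.length_history _ _ _ _)]
      cases h : act v with
      | none => rfl
      | some p => simpa using he v p.1 p.2 h S A B
    refine ⟨Q, fun s hs u v w hu hv => ?_, fun w => ?_⟩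
    · by_cases h : s = t
      · simp only [Q, h, if_true, Option.map_eq_some_iff] at hu hv
        obtain ⟨⟨w₁, f⟩, hf, rfl⟩ := hu
        obtain ⟨⟨w₂, g⟩, hg, hw⟩ := hv
        simp only at hw
        subst hw
        exact hinj u v _ f g hf hg
      · simp only [Q, h, if_false] at hu hv
        exact hP s (by omega) u v w hu hv
    · refine Subsemiring.closure_le.2 ?_
      rintro f (hf | ⟨v, hv⟩)
      · obtain ⟨e', he'⟩ := hKP w hf
        refine ⟨e', fun S _ A B l => ?_⟩
        simp only [Algorithm.history, hhist, List.append_assoc]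
        exact he' S A B _
      · refine ⟨FreeAlgebra.ι ℕ (.message t), fun S _ A B l => ?_⟩
        have hrec : Algorithm.received (fun u => (Q.interpret S).send u (localInputs A B u)
            ((Q.interpret S).history (localInputs A B) t u)) w = some (Formula.eval A B f) := by
          refine Algorithm.received_eq_some (u := v) (by simp [hsend, hv]) fun u m' hu => ?_
          rw [hsend, Option.map_eq_some_iff] at hu
          obtain ⟨⟨w₁, g⟩, hg, hw⟩ := hu
          simp only [Prod.mk.injEq] at hw
          obtain ⟨rfl, -⟩ := hw
          exact hinj u v _ g f hg hv
        simp only [FreeAlgebra.lift_ι_apply, AlgebraicAlgorithm.value, Algorithm.history, hrec]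
        rw [List.getElem?_append_left (by simp [Algorithm.length_history]),
          List.getElem?_append_right (by simp [Algorithm.length_history])]
        simp [Algorithm.length_history]

theorem Reachable.exists_solves {t : ℕ} {K : Fin n → Subsemiring (Formula n)} (hK : Reachable t K)
    {Ahat Bhat Xhat : Matrix (Fin n) (Fin n) Bool}
    (h : ∀ i k, Xhat i k = true →
      ∑ j with Ahat i j = true ∧ Bhat j k = true, varA (i, j) * varB (j, k) ∈ K i) :
    ∃ P : AlgebraicAlgorithm n, ∀ (S : Type u) [Semiring S],
      (P.interpret S).Solves t Ahat Bhat Xhat := by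
  obtain ⟨P, hP, hKP⟩ := hK.exists_algorithm
  have hex : ∀ i k, ∃ e : FreeAlgebra ℕ (LocalVar n), Xhat i k = true →
      ∀ (S : Type u) [Semiring S] (A B : Matrix (Fin n) (Fin n) S),
        FreeAlgebra.lift ℕ (AlgebraicAlgorithm.value (localInputs A B i)
          ((P.interpret S).history (localInputs A B) t i)) e =
          ∑ j with Ahat i j = true ∧ Bhat j k = true, A i j * B j k := by
    intro i k
    by_cases hik : Xhat i k = true
    · obtain ⟨e, he⟩ := hKP i (h i k hik)
      refine ⟨e, fun _ S _ A B => ?_⟩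
      simpa [Formula.eval, varA, varB] using he S A B []
    · exact ⟨0, fun h => absurd h hik⟩
  choose e he using hex
  refine ⟨⟨P.dest, P.msg, e⟩, fun S _ A B hA hB => ⟨?_, fun i k hik => ?_⟩⟩
  · intro s hs u u' w m m' hu hu'
    simp only [AlgebraicAlgorithm.interpret, Option.map_eq_some_iff, Prod.mk.injEq,
      Algorithm.length_history] at hu hu'
    obtain ⟨_, hu, rfl, -⟩ := hu
    obtain ⟨_, hu', rfl, -⟩ := hu'
    exact hP s hs u u' _ hu hu'
  · let Q : AlgebraicAlgorithm n := ⟨P.dest, P.msg, e⟩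
    have hhist : (Q.interpret S).history (localInputs A B) t =
        (P.interpret S).history (localInputs A B) t := Algorithm.history_congr fun _ _ _ => rfl
    change (Q.interpret S).output i _ ((Q.interpret S).history (localInputs A B) t i) k = _
    rw [hhist]
    refine Eq.trans (he i k hik S A B) (sum_subset (subset_univ _) fun j _ hj => ?_)
    simp only [mem_filter, mem_univ, true_and, not_and, Bool.not_eq_true] at hj
    by_cases hij : Ahat i j = true
    · rw [hB j k (hj hij), mul_zero]
    · rw [hA i j (by simpa using hij), zero_mul]

end

/-! ### The number of rounds -/

/-- The number of rounds is bounded before a semiring, or even its universe, is chosen. -/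
theorem exists_rounds (n d : ℕ) {Ahat Bhat Xhat : Matrix (Fin n) (Fin n) Bool}
    (hA : UniformlySparse d Ahat) (hB : UniformlySparse d Bhat) (hX : UniformlySparse d Xhat) :
    ∃ (T : ℕ) (K : Fin n → Subsemiring (Formula n)),
      (T : ℝ) ≤ 24 * 2 ^ 15 * (d : ℝ) ^ (1.927 : ℝ) ∧ Reachable T K ∧
      ∀ i k, Xhat i k = true →
        ∑ j with Ahat i j = true ∧ Bhat j k = true, varA (i, j) * varB (j, k) ∈ K i := by
  -- For `d = 0` no rounds are allowed; no output entry is requested then.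
  rcases Nat.eq_zero_or_pos d with rfl | hd
  · refine ⟨0, initialKnowledge, by norm_num, .init, fun i k hik => ?_⟩
    have : k ∈ (univ.filter fun k => Xhat i k = true) := by simpa using hik
    rw [card_eq_zero.1 (Nat.le_zero.1 (hX.1 i))] at this
    simp at this
  · have hd1 : (1 : ℝ) ≤ d := by exact_mod_cast hd
    -- The least natural number `r` with `d ≤ r ^ 8` is `⌈y⌉₊`, which is at most `2 * y`.
    set y : ℝ := (d : ℝ) ^ (1 / 8 : ℝ) with hy
    have hy1 : 1 ≤ y := Real.one_le_rpow hd1 (by norm_num)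
    have hy8 : y ^ 8 = d := by
      rw [hy, ← Real.rpow_natCast, ← Real.rpow_mul (by positivity)]
      norm_num
    have hr : d ≤ ⌈y⌉₊ ^ 8 := by
      have : (d : ℝ) ≤ (⌈y⌉₊ : ℝ) ^ 8 := by
        rw [← hy8]
        gcongr
        exact Nat.le_ceil y
      exact_mod_cast this
    have hr2 : (⌈y⌉₊ : ℝ) ≤ 2 * y := by
      have := Nat.ceil_lt_add_one (zero_le_one.trans hy1)
      linarith
    obtain ⟨K, hK, hout⟩ := exists_reachable_product (Nat.ceil_pos.2 (zero_lt_one.trans_le hy1))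
      (hA.mono hr) (hB.mono hr) (hX.mono hr)
    refine ⟨_, K, ?_, hK, hout⟩
    have hy15 : y ^ 15 ≤ (d : ℝ) ^ (1.927 : ℝ) := by
      rw [hy, ← Real.rpow_natCast, ← Real.rpow_mul (by positivity)]
      exact Real.rpow_le_rpow_of_exponent_le hd1 (by norm_num)
    calc ((24 * ⌈y⌉₊ ^ 15 : ℕ) : ℝ) = 24 * (⌈y⌉₊ : ℝ) ^ 15 := by push_cast; ring
      _ ≤ 24 * (2 * y) ^ 15 := by gcongr
      _ = 24 * 2 ^ 15 * y ^ 15 := by ring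
      _ ≤ _ := by gcongr

end LowBandwidth

theorem theorem2 :
    ∃ C : ℝ, ∀ (n d : ℕ) (Ahat Bhat Xhat : Matrix (Fin n) (Fin n) Bool),
      LowBandwidth.UniformlySparse d Ahat →
      LowBandwidth.UniformlySparse d Bhat →
      LowBandwidth.UniformlySparse d Xhat →
      ∃ T : ℕ, (T : ℝ) ≤ C * (d : ℝ) ^ (1.927 : ℝ) ∧
        -- `b`-bit messages, for every semiring whose elements can be encoded in `b` bits
        (∀ (b : ℕ) (S : Type*) [Semiring S], Nonempty (S ↪ (Fin b → Bool)) →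
          ∃ P : LowBandwidth.Algorithm n S (Fin b → Bool), P.Solves T Ahat Bhat Xhat) ∧
        -- one algebraic algorithm for all semirings, finite or not
        (∃ P : LowBandwidth.AlgebraicAlgorithm n, ∀ (S : Type*) [Semiring S],
          (P.interpret S).Solves T Ahat Bhat Xhat) := by
  refine ⟨24 * 2 ^ 15, fun n d Ahat Bhat Xhat hA hB hX => ?_⟩
  obtain ⟨T, K, hT, hK, hout⟩ := LowBandwidth.exists_rounds n d hA hB hX
  refine ⟨T, hT, fun b S _ ⟨enc⟩ => ?_, hK.exists_solves hout⟩
  obtain ⟨P, hP⟩ := hK.exists_solves hout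
  exact ⟨_, (hP S).encode (Function.leftInverse_invFun enc.injective)⟩
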